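/- Let $K$ be a field, let $n,d,k$ be integers with $d\ge 1$ and $1\le k\le n-1$, let $b_1,\dots,b_k$ be positive integers, and let $\alpha_{k+1}\le\cdots\le\alpha_n=d$ and $\beta_{k+1}\le\cdots\le\beta_n=d$ be nonnegative integers with $\alpha_i\le\beta_i$ for $k+1\le i\le n$. Put $\alpha_k=0$. Let $S=K[x_1,\dots,x_n]$ and let $I\subseteq S$ be the associated left PLP-polymatroidal ideal, i.e. the ideal generated by all monomials $x_1^{u_1}\cdots x_n^{u_n}$ with $$0\le u_i\le b_i\ \ (1\le i\le k),\qquad \alpha_i\le u_1+\cdots+u_i\le\beta_i\ \ (k+1\le i\le n).$$ (Equivalently, $I$ is the PLP-polymatroidal ideal of type $(\mathbf 0,\mathbf b\,|\,\boldsymbol\alpha,\boldsymbol\beta)$ with $b_i\ge d$ for $i>k$, and $\alpha_i=0$, $\beta_i=\beta_{k+1}$ for $1\le i\le k$.) For $A\subseteq[1,n]$ let $P_A=(x_i : i\in A)$, where $[p,q]=\{p,p+1,\dots,q\}$ for integers $p,q$. Then for every $A\subseteq[1,n]$, $P_A\in\operatorname{Ass}(S/I)$ if and only if one of the following holds: (a)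 $A=B\cup[k+1,t]$ for some $B\subseteq[1,k]$ and some $t$ with $k+1\le t\le n$ such that $\sum_{j\in[1,k]\setminus B}b_j<\min\{\alpha_t,\beta_{k+1}\}$, $\alpha_{t-1}<\alpha_t$, and $\alpha_i<\beta_i$ for all $k+1\le i\le t-1$; (b) $A=[s,t]$ for some $k+2\le s\le t\le n$ such that $\beta_{s-1}<\beta_s$, $\alpha_{t-1}<\alpha_t$, $\beta_{s-1}<\alpha_t$, and $\alpha_i<\beta_i$ for all $s\le i\le t-1$. Consequently $\operatorname{Ass}(S/I^m)=\operatorname{Ass}(S/I)$ for all $m\ge1$; that is, $\operatorname{astab}(I)=1$, where $\operatorname{astab}(I)$ is the smallest integer $m\ge1$ with $\operatorname{Ass}(S/I^m)=\operatorname{Ass}(S/I^{\ell})$ for all $\ell\ge m$. -/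

import Mathlib

noncomputable section

/-- `u₁ + ⋯ + uᵢ` for an exponent vector `u` of a monomial in `n` variables. Positions are counted
from `1` to `n`: the variable with index `j : Fin n` is the `(j + 1)`-st one. -/
def partialSum {n : ℕ} (u : Fin n →₀ ℕ) (i : ℕ) : ℕ :=
  ∑ j ∈ Finset.univ.filter (fun j : Fin n => (j : ℕ) + 1 ≤ i), u j

/-- The conditions on `α` and `β` in a type `(a, b | α, β)` of a pruned lattice path polymatroid of
rank `d` on the ground set `[n]`. Only the entries at positions `1, …, n` of the sequences
matter. -/
structure IsPLPType (n d : ℕ) (α β : ℕ → ℕ) : Prop where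
  n_pos : 0 < n
  d_pos : 0 < d
  α_mono : ∀ i j, 1 ≤ i → i ≤ j → j ≤ n → α i ≤ α j
  β_mono : ∀ i j, 1 ≤ i → i ≤ j → j ≤ n → β i ≤ β j
  α_last : α n = d
  β_last : β n = d
  α_le_β : ∀ i, 1 ≤ i → i ≤ n → α i ≤ β i

/-- The set of bases of the pruned lattice path polymatroid of type `(a, b | α, β)` on `[n]`. -/
def plpBases (n : ℕ) (a b α β : ℕ → ℕ) : Set (Fin n →₀ ℕ) :=
  {u | (∀ j : Fin n, a (j + 1) ≤ u j ∧ u j ≤ b (j + 1)) ∧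
    ∀ i, 1 ≤ i → i ≤ n → α i ≤ partialSum u i ∧ partialSum u i ≤ β i}

/-- The PLP-polymatroidal ideal of type `(a, b | α, β)` in `K[x₁, …, xₙ]`: the ideal generated by
the monomials whose exponent vectors are the bases. -/
def plpIdeal (K : Type*) [Field K] (n : ℕ) (a b α β : ℕ → ℕ) : Ideal (MvPolynomial (Fin n) K) :=
  Ideal.span ((fun u => MvPolynomial.monomial u (1 : K)) '' plpBases n a b α β)

/-- The conditions on a type `(0, b | α, β)` that make the ideal a left PLP-polymatroidal ideal
with parameter `k`: only the first `k` variables are bounded individually (by positive bounds),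
and only the partial sums at positions `k + 1, …, n` are constrained. -/
structure IsLeftPLPType (n d k : ℕ) (b α β : ℕ → ℕ) : Prop extends IsPLPType n d α β where
  one_le_k : 1 ≤ k
  k_lt_n : k < n
  b_pos : ∀ i, 1 ≤ i → i ≤ k → 0 < b i
  le_b : ∀ i, k + 1 ≤ i → i ≤ n → d ≤ b i
  α_left : ∀ i, 1 ≤ i → i ≤ k → α i = 0
  β_left : ∀ i, 1 ≤ i → i ≤ k → β i = β (k + 1)

/-- The monomial prime ideal `P_A = (xᵢ : i ∈ A)` of `K[x₁, …, xₙ]`, for `A ⊆ [1, n]`. -/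
def monomialPrime (K : Type*) [Field K] (n : ℕ) (A : Finset ℕ) : Ideal (MvPolynomial (Fin n) K) :=
  Ideal.span {f | ∃ j : Fin n, (j : ℕ) + 1 ∈ A ∧ f = MvPolynomial.X j}

/-- `astab I` is the smallest integer `m ≥ 1` such that `Ass (S / I ^ m) = Ass (S / I ^ l)` for all
`l ≥ m`. -/
def astab {S : Type*} [CommRing S] (I : Ideal S) : ℕ :=
  sInf {m : ℕ | 1 ≤ m ∧ ∀ l, m ≤ l →
    associatedPrimes S (S ⧸ I ^ m) = associatedPrimes S (S ⧸ I ^ l)}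

end

/-! An ideal generated by monomials has only primes `P_A` as associated primes, each of the form `I
: x^w`. The question is therefore combinatorial: `x_i x^w` must lie in `I` for `i ∈ A`, while no
multiple of `x^w` by a monomial in the other variables does (`IsColonWitness`).

Membership in `I` is linear. Let `C_i` be the partial sums of `w` with the first `k` entries capped
by `b`. Then `x^w ∈ I` iff `α_t ≤ C_t` and `α_t - β_j ≤ C_t - C_j` for all relevant `j ≤ t`
(`exists_mem_plpBases_le_iff`); a greedy choice of partial sums gives sufficiency.

For a witness, some inequality fails, and raising any single entry in `A` repairs it. Entries
outside `A` may be taken huge, so beyond `k` the set `A` is exactly the interval of positions which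
that inequality sees: `(k, t]` for the first kind, giving (a), and `(j, t]` for the second, giving
(b) with `s = j + 1`. The strict inequalities in (a) and (b) come from comparison with inequalities
not affected by the raised entry. Conversely, from (a) or (b) one writes down a vector that misses
one inequality by exactly one.

For powers, floor division of partial sums gives integer decomposition, so `I^m` is the ideal of the
type scaled by `m` (`plpIdeal_pow`). Conditions (a) and (b) are homogeneous, hence `Ass` does not
change. -/

/-! ### Supports of polynomials and primes generated by variables -/

open MvPolynomial in
theorem exists_coeff_restrict {σ R : Type*} [CommSemiring R] (g : MvPolynomial σ R)
    (p : (σ →₀ ℕ) → Prop) [DecidablePred p] :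
    ∃ g' : MvPolynomial σ R, ∀ m, coeff m g' = if p m then coeff m g else 0 := by
  classical
  refine ⟨∑ m ∈ g.support.filter p, monomial m (coeff m g), fun m => ?_⟩
  simp only [coeff_sum, coeff_monomial, Finset.sum_ite_eq', Finset.mem_filter, mem_support_iff]
  by_cases h1 : p m <;> by_cases h2 : coeff m g = 0 <;> simp [h1, h2]

open MvPolynomial in
theorem exists_add_mem_support_mul {σ R : Type*} [CommRing R] [IsDomain R]
    {f g : MvPolynomial σ R} (hf : f ≠ 0) (hg : g ≠ 0) :
    ∃ a ∈ f.support, ∃ b ∈ g.support, a + b ∈ (f * g).support := by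
  classical
  have h : (f * g).support.Nonempty := by
    simpa [Finset.nonempty_iff_ne_empty, support_eq_empty] using ⟨hf, hg⟩
  obtain ⟨c, hc⟩ := h
  obtain ⟨a, ha, b, hb, rfl⟩ := Finset.mem_add.1 (support_mul f g hc)
  exact ⟨a, ha, b, hb, hc⟩

open MvPolynomial in
/-- Every polynomial is congruent, modulo the ideal generated by a set of variables, to one that
does not involve these variables. -/
theorem exists_sub_mem_span_X {σ R : Type*} [CommRing R] (A : Set σ) (g : MvPolynomial σ R) :
    ∃ g' : MvPolynomial σ R, g - g' ∈ Ideal.span (X '' A : Set (MvPolynomial σ R)) ∧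
      ∀ m ∈ g'.support, ∀ i ∈ A, m i = 0 := by
  classical
  obtain ⟨g', hg'⟩ := exists_coeff_restrict g (fun m => ∀ i ∈ A, m i = 0)
  refine ⟨g', mem_ideal_span_X_image.2 fun m hm => ?_, fun m hm => ?_⟩
  · by_contra! hcon
    rw [mem_support_iff, coeff_sub, hg', if_pos hcon, sub_self] at hm
    exact hm rfl
  · by_contra hcon
    rw [mem_support_iff, hg', if_neg hcon] at hm
    exact hm rfl

open MvPolynomial in
theorem eq_zero_of_mem_span_X {σ R : Type*} [CommRing R] {A : Set σ} {g : MvPolynomial σ R}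
    (hg : g ∈ Ideal.span (X '' A : Set (MvPolynomial σ R)))
    (h : ∀ m ∈ g.support, ∀ i ∈ A, m i = 0) : g = 0 := by
  rw [← support_eq_empty, Finset.eq_empty_iff_forall_notMem]
  intro m hm
  obtain ⟨i, hi, hmi⟩ := mem_ideal_span_X_image.1 hg m hm
  exact hmi (h m hm i hi)

open MvPolynomial in
-- Each class modulo the ideal has a unique representative free of the variables in `A`, and these
-- representatives multiply inside a polynomial ring, which is a domain.
theorem isPrime_span_X_image {σ R : Type*} [CommRing R] [IsDomain R] (A : Set σ) :
    (Ideal.span (X '' A : Set (MvPolynomial σ R))).IsPrime := by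
  classical
  set P := Ideal.span (X '' A : Set (MvPolynomial σ R)) with hP
  refine ⟨fun htop => ?_, fun {f g} hfg => ?_⟩
  · have h1 : (1 : MvPolynomial σ R) ∈ P := htop ▸ Submodule.mem_top
    refine one_ne_zero (eq_zero_of_mem_span_X h1 fun m hm i _ => ?_)
    have : m = 0 := by
      by_contra hne
      rw [mem_support_iff, coeff_one, if_neg (Ne.symm hne)] at hm
      exact hm rfl
    simp [this]
  · obtain ⟨f', hf', hf0⟩ := exists_sub_mem_span_X A f
    obtain ⟨g', hg', hg0⟩ := exists_sub_mem_span_X A g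
    have hmem : f' * g' ∈ P := by
      have : f' * g' = f * g - (f * (g - g') + g' * (f - f')) := by ring
      rw [this]
      exact P.sub_mem hfg (P.add_mem (P.mul_mem_left _ hg') (P.mul_mem_left _ hf'))
    have hzero : f' * g' = 0 := by
      refine eq_zero_of_mem_span_X hmem fun m hm i hi => ?_
      obtain ⟨a, ha, b, hb, rfl⟩ := Finset.mem_add.1 (support_mul f' g' hm)
      simp [hf0 a ha i hi, hg0 b hb i hi]
    rcases mul_eq_zero.1 hzero with h | h
    · left; simpa [h] using hf'
    · right; simpa [h] using hg'

theorem mem_associatedPrimes_quotient_iff {R : Type*} [CommRing R] [IsNoetherianRing R]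
    (I P : Ideal R) :
    P ∈ associatedPrimes R (R ⧸ I) ↔ P.IsPrime ∧ ∃ f : R, ∀ g, g ∈ P ↔ g * f ∈ I := by
  rw [AssociatedPrimes.mem_iff, IsAssociatedPrime, Submodule.isAssociatedPrime_iff]
  refine and_congr_right fun _ => ⟨?_, ?_⟩
  · rintro ⟨x, hx⟩
    obtain ⟨f, rfl⟩ := Ideal.Quotient.mk_surjective x
    refine ⟨f, fun g => ?_⟩
    rw [hx, Submodule.mem_colon_singleton, Submodule.mem_bot, ← Ideal.Quotient.eq_zero_iff_mem]
    rfl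
  · rintro ⟨f, hf⟩
    refine ⟨Ideal.Quotient.mk I f, ?_⟩
    ext g
    rw [hf, Submodule.mem_colon_singleton, Submodule.mem_bot, ← Ideal.Quotient.eq_zero_iff_mem]
    rfl

/-! ### Associated primes of monomial ideals as colons by monomials -/

/-- The colon of the monomial ideal with exponent set `s` by the monomial with exponent `w` is the
ideal generated by the variables in `A`. -/
structure IsColonWitness {σ : Type*} (s : Set (σ →₀ ℕ)) (A : Set σ) (w : σ →₀ ℕ) : Prop where
  add_single : ∀ i ∈ A, ∃ u ∈ s, u ≤ w + Finsupp.single i 1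
  not_add : ∀ v : σ →₀ ℕ, (∀ i ∈ A, v i = 0) → ¬ ∃ u ∈ s, u ≤ w + v

open MvPolynomial in
theorem IsColonWitness.mem_associatedPrimes {σ K : Type*} [Finite σ] [Field K]
    {s : Set (σ →₀ ℕ)} {A : Set σ} {w : σ →₀ ℕ} (h : IsColonWitness s A w) :
    Ideal.span (X '' A : Set (MvPolynomial σ K)) ∈ associatedPrimes (MvPolynomial σ K)
      (MvPolynomial σ K ⧸ Ideal.span ((fun u => monomial u (1 : K)) '' s)) := by
  classical
  rw [mem_associatedPrimes_quotient_iff]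
  refine ⟨isPrime_span_X_image A, monomial w 1, fun g => ?_⟩
  rw [mem_ideal_span_X_image, mem_ideal_span_monomial_image]
  constructor
  · intro hg x hx
    rw [mem_support_iff, coeff_mul_monomial'] at hx
    have hwx : w ≤ x := by
      by_contra hcon
      exact hx (if_neg hcon)
    rw [if_pos hwx, mul_one] at hx
    obtain ⟨i, hi, hne⟩ := hg _ (mem_support_iff.2 hx)
    obtain ⟨u, hu, hle⟩ := h.add_single i hi
    refine ⟨u, hu, hle.trans ?_⟩
    calc w + Finsupp.single i 1 ≤ w + (x - w) := by
          gcongr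
          rw [Finsupp.single_le_iff]
          exact Nat.one_le_iff_ne_zero.2 hne
      _ = x := add_tsub_cancel_of_le hwx
  · intro hg m hm
    by_contra! hcon
    refine h.not_add m hcon ?_
    have := hg (m + w) (by rwa [mem_support_iff, coeff_mul_monomial, mul_one, ← mem_support_iff])
    rwa [add_comm] at this

open MvPolynomial in
-- Write `P = I : f`. The terms of `f` that enter `I` after multiplication by a monomial free of `A`
-- are discarded; any surviving term serves as the witness.
theorem exists_isColonWitness {σ K : Type*} [Finite σ] [Field K] {s : Set (σ →₀ ℕ)}
    {P : Ideal (MvPolynomial σ K)}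
    (hP : P ∈ associatedPrimes (MvPolynomial σ K)
      (MvPolynomial σ K ⧸ Ideal.span ((fun u => monomial u (1 : K)) '' s))) :
    ∃ (A : Set σ) (w : σ →₀ ℕ), P = Ideal.span (X '' A) ∧ IsColonWitness s A w := by
  classical
  have := Fintype.ofFinite σ
  obtain ⟨hprime, f, hf⟩ := (mem_associatedPrimes_quotient_iff _ _).1 hP
  set I := Ideal.span ((fun u => monomial u (1 : K)) '' s) with hI
  set A : Set σ := {i | (X i : MvPolynomial σ K) ∈ P} with hA
  have hAP : Ideal.span (X '' A) ≤ P := by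
    rw [Ideal.span_le]
    rintro _ ⟨i, hi, rfl⟩
    exact hi
  have hmon : ∀ v : σ →₀ ℕ, (∀ i ∈ A, v i = 0) → monomial v (1 : K) ∉ P := by
    intro v hv hmem
    rw [monomial_eq, C_1, one_mul, Finsupp.prod, hprime.prod_mem_iff] at hmem
    obtain ⟨i, hi, hmem⟩ := hmem
    exact Finsupp.mem_support_iff.1 hi (hv i (hprime.mem_of_pow_mem _ hmem))
  have hup : ∀ {x y : σ →₀ ℕ}, x ≤ y → (∃ u ∈ s, u ≤ x) → ∃ u ∈ s, u ≤ y :=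
    fun hxy ⟨u, hu, hux⟩ => ⟨u, hu, hux.trans hxy⟩
  -- `good b` says that `x^b` stays outside `I` even after the variables not in `A` are inverted.
  let good : (σ →₀ ℕ) → Prop := fun b => ∀ v : σ →₀ ℕ, (∀ i ∈ A, v i = 0) → ¬ ∃ u ∈ s, u ≤ b + v
  obtain ⟨f', hf'⟩ := exists_coeff_restrict f good
  have hgood : ∀ b ∈ f'.support, good b ∧ b ∈ f.support := by
    intro b hb
    rw [mem_support_iff, hf'] at hb
    by_cases h : good b
    · rw [if_pos h] at hb
      exact ⟨h, mem_support_iff.2 hb⟩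
    · rw [if_neg h] at hb
      exact absurd rfl hb
  have hex : ∀ b, ∃ v : σ →₀ ℕ, (∀ i ∈ A, v i = 0) ∧ (¬ good b → ∃ u ∈ s, u ≤ b + v) := by
    intro b
    by_cases h : good b
    · exact ⟨0, fun _ _ => rfl, fun h' => absurd h h'⟩
    · simp only [good] at h
      push Not at h
      obtain ⟨v, hv, h⟩ := h
      exact ⟨v, hv, fun _ => h⟩
  choose V hV0 hV using hex
  -- One monomial `x^z`, free of `A`, sends all the bad terms of `f` into `I` at once. It is not in
  -- the prime `P`, so `f` cannot consist of bad terms only.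
  set z : σ →₀ ℕ := ∑ b ∈ f.support, V b with hz
  have hz0 : ∀ i ∈ A, z i = 0 := by
    intro i hi
    rw [hz, Finsupp.finsetSum_apply]
    exact Finset.sum_eq_zero fun b _ => hV0 b i hi
  have hrest : (f - f') * monomial z 1 ∈ I := by
    rw [hI, mem_ideal_span_monomial_image]
    intro x hx
    rw [mem_support_iff, coeff_mul_monomial'] at hx
    have hzx : z ≤ x := by
      by_contra hcon
      exact hx (if_neg hcon)
    rw [if_pos hzx, mul_one, coeff_sub, hf'] at hx
    by_cases hg : good (x - z)
    · rw [if_pos hg, sub_self] at hx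
      exact absurd rfl hx
    · rw [if_neg hg, sub_zero] at hx
      refine hup ?_ (hV _ hg)
      calc x - z + V (x - z) ≤ x - z + z := by
            gcongr
            exact Finset.single_le_sum (f := V) (fun _ _ => zero_le) (mem_support_iff.2 hx)
        _ = x := tsub_add_cancel_of_le hzx
  have hf0 : f' ≠ 0 := by
    rintro rfl
    rw [sub_zero, mul_comm, ← hf] at hrest
    exact hmon z hz0 hrest
  have hPA : P = Ideal.span (X '' A) := by
    refine le_antisymm (fun g hg => ?_) hAP
    obtain ⟨g', hg', hg0⟩ := exists_sub_mem_span_X A g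
    suffices h : g' = 0 by simpa [h] using hg'
    by_contra hne
    have hgP : g' ∈ P := by simpa using P.sub_mem hg (hAP hg')
    have hmem : (g' * f') * monomial z 1 ∈ I := by
      have h1 := I.mul_mem_right (monomial z 1) ((hf g').1 hgP)
      have h2 := I.mul_mem_left g' hrest
      have : g' * f' * monomial z 1 = g' * f * monomial z 1 - g' * ((f - f') * monomial z 1) := by
        ring
      rw [this]
      exact I.sub_mem h1 h2
    -- A monomial of `g' * f'` is a good one times one free of `A`; its multiple by `x^z` lies in
    -- `I`, contradicting goodness.
    obtain ⟨a, ha, b, hb, hab⟩ := exists_add_mem_support_mul hne hf0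
    rw [hI, mem_ideal_span_monomial_image] at hmem
    have h := hmem (a + b + z)
      (by rwa [mem_support_iff, coeff_mul_monomial, mul_one, ← mem_support_iff])
    refine (hgood b hb).1 (a + z) (fun i hi => by simp [hg0 a ha i hi, hz0 i hi]) ?_
    convert h using 4
    abel
  obtain ⟨b, hb⟩ : f'.support.Nonempty := by
    rwa [Finset.nonempty_iff_ne_empty, Ne, support_eq_empty]
  refine ⟨A, b, hPA, fun i hi => ?_, (hgood b hb).1⟩
  have h := (hf (X i)).1 hi
  rw [hI, mem_ideal_span_monomial_image] at h
  refine h _ ?_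
  rw [mul_comm, X, mem_support_iff, coeff_mul_monomial, mul_one, ← mem_support_iff]
  exact (hgood b hb).2

open MvPolynomial in
theorem span_X_image_injective {σ K : Type*} [Field K] :
    Function.Injective fun A : Set σ => Ideal.span (X '' A : Set (MvPolynomial σ K)) := by
  classical
  have key : ∀ {A B : Set σ}, Ideal.span (X '' A : Set (MvPolynomial σ K)) = Ideal.span (X '' B) →
      A ⊆ B := by
    intro A B h i hi
    have hX : (X i : MvPolynomial σ K) ∈ Ideal.span (X '' B) :=
      h ▸ Ideal.subset_span (Set.mem_image_of_mem _ hi)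
    obtain ⟨j, hj, hne⟩ := mem_ideal_span_X_image.1 hX (Finsupp.single i 1)
      (by rw [support_X]; exact Finset.mem_singleton_self _)
    rw [Finsupp.single_apply] at hne
    by_cases hij : i = j
    · rwa [hij]
    · exact absurd (if_neg hij) hne
  exact fun A B h => Set.Subset.antisymm (key h) (key h.symm)

open MvPolynomial in
theorem mem_associatedPrimes_span_monomial_iff {σ K : Type*} [Finite σ] [Field K]
    {s : Set (σ →₀ ℕ)} {P : Ideal (MvPolynomial σ K)} :
    P ∈ associatedPrimes (MvPolynomial σ K)
      (MvPolynomial σ K ⧸ Ideal.span ((fun u => monomial u (1 : K)) '' s)) ↔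
    ∃ A : Set σ, P = Ideal.span (X '' A) ∧ ∃ w, IsColonWitness s A w := by
  constructor
  · intro h
    obtain ⟨A, w, h1, h2⟩ := exists_isColonWitness h
    exact ⟨A, h1, w, h2⟩
  · rintro ⟨A, rfl, w, hw⟩
    exact hw.mem_associatedPrimes

/-! ### Exponent vectors as sequences, and sums over intervals -/

/-- The entries of an exponent vector as a sequence, extended by zero. -/
def natExt {n : ℕ} (u : Fin n →₀ ℕ) (j : ℕ) : ℕ :=
  if h : j < n then u ⟨j, h⟩ else 0

theorem natExt_of_lt {n : ℕ} (u : Fin n →₀ ℕ) {j : ℕ} (h : j < n) : natExt u j = u ⟨j, h⟩ :=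
  dif_pos h

theorem natExt_add {n : ℕ} (u v : Fin n →₀ ℕ) (j : ℕ) :
    natExt (u + v) j = natExt u j + natExt v j := by
  unfold natExt
  split <;> simp

theorem natExt_mono {n : ℕ} {u v : Fin n →₀ ℕ} (h : u ≤ v) (j : ℕ) :
    natExt u j ≤ natExt v j := by
  unfold natExt
  split
  · exact h _
  · exact le_rfl

theorem natExt_single {n : ℕ} (i : Fin n) (j : ℕ) :
    natExt (Finsupp.single i 1) j = if j = i then 1 else 0 := by
  unfold natExt
  split
  · simp [Finsupp.single_apply, Fin.ext_iff, eq_comm]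
  · rw [if_neg (by have := i.2; omega)]

theorem natExt_ofFun {n : ℕ} (c : ℕ → ℕ) {j : ℕ} (h : j < n) :
    natExt (Finsupp.equivFunOnFinite.symm fun j : Fin n => c j) j = c j := by
  simp [natExt, h]

theorem partialSum_eq_sum_range {n : ℕ} (u : Fin n →₀ ℕ) (i : ℕ) :
    partialSum u i = ∑ j ∈ Finset.range i, natExt u j := by
  have h1 : ∑ j ∈ Finset.range i, natExt u j =
      ∑ j ∈ Finset.range n, if j + 1 ≤ i then natExt u j else 0 := by
    rw [← Finset.sum_filter]
    refine (Finset.sum_subset_zero_on_sdiff ?_ ?_ fun _ _ => rfl).symm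
    · intro j hj
      simp only [Finset.mem_filter, Finset.mem_range] at hj ⊢
      omega
    · intro j hj
      simp only [Finset.mem_sdiff, Finset.mem_filter, Finset.mem_range] at hj
      exact dif_neg (by omega)
  rw [h1, ← Fin.sum_univ_eq_sum_range (fun j => if j + 1 ≤ i then natExt u j else 0) n, partialSum,
    Finset.sum_filter]
  simp [natExt]

/-- This compares the sums over `[j, t)`; the initial sums are moved across because subtraction in
`ℕ` truncates. -/
theorem sum_range_add_le_of_le {f g : ℕ → ℕ} {j t : ℕ} (hjt : j ≤ t)
    (h : ∀ i, j ≤ i → i < t → f i ≤ g i) :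
    ∑ i ∈ Finset.range t, f i + ∑ i ∈ Finset.range j, g i ≤
      ∑ i ∈ Finset.range t, g i + ∑ i ∈ Finset.range j, f i := by
  rw [← Finset.sum_range_add_sum_Ico f hjt, ← Finset.sum_range_add_sum_Ico g hjt]
  have : ∑ i ∈ Finset.Ico j t, f i ≤ ∑ i ∈ Finset.Ico j t, g i :=
    Finset.sum_le_sum fun i hi => h i (Finset.mem_Ico.1 hi).1 (Finset.mem_Ico.1 hi).2
  omega

theorem sum_range_add_lt_of_le {f g : ℕ → ℕ} {j t p : ℕ} (hjp : j ≤ p) (hpt : p < t)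
    (h : ∀ i, j ≤ i → i < t → f i ≤ g i) (hp : f p < g p) :
    ∑ i ∈ Finset.range t, f i + ∑ i ∈ Finset.range j, g i <
      ∑ i ∈ Finset.range t, g i + ∑ i ∈ Finset.range j, f i := by
  rw [← Finset.sum_range_add_sum_Ico f (hjp.trans hpt.le),
    ← Finset.sum_range_add_sum_Ico g (hjp.trans hpt.le)]
  have : ∑ i ∈ Finset.Ico j t, f i < ∑ i ∈ Finset.Ico j t, g i :=
    Finset.sum_lt_sum (fun i hi => h i (Finset.mem_Ico.1 hi).1 (Finset.mem_Ico.1 hi).2)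
      ⟨p, Finset.mem_Ico.2 ⟨hjp, hpt⟩, hp⟩
  omega

/-! ### Membership in the ideal by linear inequalities -/

/-- The entries of an exponent vector, the first `k` of them capped by `b`. -/
def cappedCoord {n : ℕ} (k : ℕ) (b : ℕ → ℕ) (w : Fin n →₀ ℕ) (j : ℕ) : ℕ :=
  if j < k then min (natExt w j) (b (j + 1)) else natExt w j

def cappedSum {n : ℕ} (k : ℕ) (b : ℕ → ℕ) (w : Fin n →₀ ℕ) (i : ℕ) : ℕ :=
  ∑ j ∈ Finset.range i, cappedCoord k b w j

theorem cappedSum_succ {n : ℕ} (k : ℕ) (b : ℕ → ℕ) (w : Fin n →₀ ℕ) (i : ℕ) :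
    cappedSum k b w (i + 1) = cappedSum k b w i + cappedCoord k b w i :=
  Finset.sum_range_succ _ _

theorem cappedSum_mono {n : ℕ} (k : ℕ) (b : ℕ → ℕ) (w : Fin n →₀ ℕ) :
    Monotone (cappedSum k b w) :=
  monotone_nat_of_le_succ fun i => by rw [cappedSum_succ]; omega

theorem cappedCoord_mono {n : ℕ} (k : ℕ) (b : ℕ → ℕ) {w x : Fin n →₀ ℕ} (h : w ≤ x) (j : ℕ) :
    cappedCoord k b w j ≤ cappedCoord k b x j := by
  have := natExt_mono h j
  unfold cappedCoord
  split
  · omega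
  · exact this

/-- The maximal partial sums, bounded by `β`, of a sequence dominated by `c`. -/
def greedySum (c β : ℕ → ℕ) : ℕ → ℕ
  | 0 => 0
  | i + 1 => min (greedySum c β i + c i) (β (i + 1))

/-- Look at the last index `j` at which the bound `β j` was the minimum: from there on the greedy
sum just accumulates `c`. If there is none, it is the full sum of `c`. -/
theorem greedySum_eq (c β : ℕ → ℕ) (i : ℕ) :
    greedySum c β i = ∑ l ∈ Finset.range i, c l ∨
      ∃ j, 1 ≤ j ∧ j ≤ i ∧
        greedySum c β i + ∑ l ∈ Finset.range j, c l = β j + ∑ l ∈ Finset.range i, c l := by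
  induction i with
  | zero => left; simp [greedySum]
  | succ i ih =>
    rw [greedySum, Finset.sum_range_succ]
    rcases le_total (greedySum c β i + c i) (β (i + 1)) with h | h
    · rw [min_eq_left h]
      rcases ih with ih | ⟨j, hj1, hj2, hj⟩
      · left; rw [ih]
      · right; exact ⟨j, hj1, by omega, by omega⟩
    · rw [min_eq_right h]
      right
      exact ⟨i + 1, by omega, le_rfl, by rw [Finset.sum_range_succ]⟩

/-- A monomial lies in a left PLP-polymatroidal ideal if and only if its capped partial sums
satisfy finitely many linear inequalities. -/
theorem exists_mem_plpBases_le_iff {n d k : ℕ} {b α β : ℕ → ℕ} (h : IsLeftPLPType n d k b α β)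
    (w : Fin n →₀ ℕ) :
    (∃ u ∈ plpBases n 0 b α β, u ≤ w) ↔
      (∀ t, k + 1 ≤ t → t ≤ n → α t ≤ cappedSum k b w t) ∧
        ∀ j t, k + 1 ≤ j → j ≤ t → t ≤ n →
          α t + cappedSum k b w j ≤ β j + cappedSum k b w t := by
  constructor
  · rintro ⟨u, ⟨hu1, hu2⟩, huw⟩
    have hc : ∀ j, natExt u j ≤ cappedCoord k b w j := by
      intro j
      have h1 := natExt_mono huw j
      unfold cappedCoord
      split
      · have h2 : j < n := by have := h.k_lt_n; omega
        have h3 := (hu1 ⟨j, h2⟩).2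
        rw [← natExt_of_lt u h2] at h3
        exact le_min h1 h3
      · exact h1
    have hdiff : ∀ j t, j ≤ t →
        partialSum u t + cappedSum k b w j ≤ cappedSum k b w t + partialSum u j := by
      intro j t hjt
      rw [partialSum_eq_sum_range, partialSum_eq_sum_range]
      exact sum_range_add_le_of_le hjt fun i _ _ => hc i
    constructor
    · intro t ht1 ht2
      have h1 := hdiff 0 t (Nat.zero_le _)
      have h2 := hu2 t (by omega) ht2
      simp only [cappedSum, partialSum_eq_sum_range, Finset.range_zero, Finset.sum_empty] at *
      omega
    · intro j t hj hjt ht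
      have h1 := hdiff j t hjt
      have h2 := hu2 t (by omega) ht
      have h3 := hu2 j (by omega) (by omega)
      omega
  · rintro ⟨hw1, hw2⟩
    set c := cappedCoord k b w with hc
    set M := greedySum c β with hM
    have hMβ : ∀ i, 1 ≤ i → M i ≤ β i := by
      intro i hi
      obtain ⟨i, rfl⟩ : ∃ j, i = j + 1 := ⟨i - 1, by omega⟩
      exact min_le_right _ _
    have hMc : ∀ i, M (i + 1) ≤ M i + c i := fun i => min_le_left _ _
    have hMmono : ∀ i, i < n → M i ≤ M (i + 1) := by
      intro i hi
      refine le_min (Nat.le_add_right _ _) ?_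
      rcases Nat.eq_zero_or_pos i with rfl | hpos
      · exact Nat.zero_le _
      · exact (hMβ i hpos).trans (h.β_mono i (i + 1) hpos (by omega) (by omega))
    -- The basis below `w` is the vector whose partial sums are the greedy ones.
    set u : Fin n →₀ ℕ := Finsupp.equivFunOnFinite.symm fun j : Fin n => M (j + 1) - M j with hu
    have hext : ∀ j, j < n → natExt u j = M (j + 1) - M j :=
      fun j hj => natExt_ofFun (fun j => M (j + 1) - M j) hj
    have hsum : ∀ i, i ≤ n → partialSum u i = M i := by
      intro i hi
      rw [partialSum_eq_sum_range]
      induction i with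
      | zero => rfl
      | succ i ih =>
        rw [Finset.sum_range_succ, ih (by omega), hext i (by omega)]
        have := hMmono i (by omega)
        omega
    have huc : ∀ j : Fin n, u j ≤ c j := by
      intro j
      rw [← natExt_of_lt u j.2, hext j j.2]
      have := hMc j
      omega
    have hMα : ∀ t, k + 1 ≤ t → t ≤ n → α t ≤ M t := by
      intro t ht1 ht2
      rcases greedySum_eq c β t with h1 | ⟨j, hj1, hj2, hj⟩
      · exact (hw1 t ht1 ht2).trans h1.ge
      · change M t + cappedSum k b w j = β j + cappedSum k b w t at hj
        -- The greedy sum also respects `β` at positions up to `k`, where no inequality is assumed;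
        -- there `β j = β (k + 1)`, so the inequality at `k + 1` suffices.
        by_cases hjk : j ≤ k
        · have h1 := hw2 (k + 1) t le_rfl ht1 ht2
          have h2 := h.β_left j hj1 hjk
          have h3 := cappedSum_mono k b w (show j ≤ k + 1 by omega)
          omega
        · have h1 := hw2 j t (by omega) hj2 ht2
          omega
    refine ⟨u, ⟨fun j => ⟨Nat.zero_le _, ?_⟩, fun i hi1 hi2 => ?_⟩, fun j => ?_⟩
    · by_cases hj : (j : ℕ) < k
      · refine (huc j).trans ?_
        rw [hc, cappedCoord, if_pos hj]
        exact min_le_right _ _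
      -- Beyond `k` the individual bound is automatic: an entry is at most `β n = d ≤ b (j + 1)`.
      · have h1 := hMβ (j + 1) (by omega)
        have h2 := h.β_mono (j + 1) n (by omega) (by omega) le_rfl
        have h3 := h.le_b (j + 1) (by omega) (by omega)
        have h4 := h.β_last
        have h5 := hext j j.2
        rw [natExt_of_lt u j.2] at h5
        change u j ≤ _
        have h6 : u j = M (j + 1) - M j := h5
        omega
    · rw [hsum i hi2]
      refine ⟨?_, hMβ i hi1⟩
      by_cases hik : i ≤ k
      · rw [h.α_left i hi1 hik]
        exact Nat.zero_le _
      · exact hMα i (by omega) hi2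
    · refine (huc j).trans ?_
      rw [hc, cappedCoord, natExt_of_lt w j.2]
      split
      · exact min_le_left _ _
      · exact le_rfl

/-! ### Necessity of the conditions -/

/-- The combinatorial conditions characterizing the sets of variables that generate an associated
prime of a left PLP-polymatroidal ideal. -/
def IsPLPPrimeIndex (n k : ℕ) (b α β : ℕ → ℕ) (A : Finset ℕ) : Prop :=
  (∃ (B : Finset ℕ) (t : ℕ), B ⊆ Finset.Icc 1 k ∧ k + 1 ≤ t ∧ t ≤ n ∧
    A = B ∪ Finset.Icc (k + 1) t ∧
    ∑ j ∈ Finset.Icc 1 k \ B, b j < min (α t) (β (k + 1)) ∧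
    α (t - 1) < α t ∧
    ∀ i, k + 1 ≤ i → i < t → α i < β i) ∨
  (∃ s t : ℕ, k + 2 ≤ s ∧ s ≤ t ∧ t ≤ n ∧
    A = Finset.Icc s t ∧
    β (s - 1) < β s ∧
    α (t - 1) < α t ∧
    β (s - 1) < α t ∧
    ∀ i, s ≤ i → i < t → α i < β i)

theorem sum_Icc_sdiff_eq_sum_range (k : ℕ) (B : Finset ℕ) (b : ℕ → ℕ) :
    ∑ j ∈ Finset.Icc 1 k \ B, b j =
      ∑ j ∈ Finset.range k, if j + 1 ∈ B then 0 else b (j + 1) := by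
  induction k with
  | zero => simp
  | succ k ih =>
    rw [Finset.sum_range_succ, ← ih]
    have hI : Finset.Icc 1 (k + 1) = insert (k + 1) (Finset.Icc 1 k) := by
      ext x; simp only [Finset.mem_Icc, Finset.mem_insert]; omega
    rw [hI]
    by_cases hk : k + 1 ∈ B
    · rw [Finset.insert_sdiff_of_mem _ hk, if_pos hk, add_zero]
    · rw [Finset.insert_sdiff_of_notMem _ hk, if_neg hk, Finset.sum_insert (by simp), add_comm]

theorem cappedCoord_add_single_le {n : ℕ} (k : ℕ) (b : ℕ → ℕ) (w : Fin n →₀ ℕ) (i : Fin n)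
    (j : ℕ) :
    cappedCoord k b (w + Finsupp.single i 1) j ≤ cappedCoord k b w j + if j = i then 1 else 0 := by
  unfold cappedCoord
  rw [natExt_add, natExt_single]
  split <;> split <;> omega

/-- This carries inequalities valid for `w + e_i` back to `w`, with a loss of one only when the
interval `(j, t]` contains the position `i + 1`. -/
theorem cappedSum_add_single_le {n : ℕ} (k : ℕ) (b : ℕ → ℕ) (w : Fin n →₀ ℕ) (i : Fin n)
    {j t : ℕ} (hjt : j ≤ t) :
    cappedSum k b (w + Finsupp.single i 1) t + cappedSum k b w j ≤
      cappedSum k b w t + cappedSum k b (w + Finsupp.single i 1) j +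
        if j < (i : ℕ) + 1 ∧ (i : ℕ) + 1 ≤ t then 1 else 0 := by
  induction t, hjt using Nat.le_induction with
  | base => omega
  | succ t hjt ih =>
    have h := cappedCoord_add_single_le k b w i t
    rw [cappedSum_succ, cappedSum_succ]
    split_ifs at * <;> omega

/-- The failing inequalities of a colon witness determine the shape of its set of variables. -/
theorem isPLPPrimeIndex_of_fails {n d k : ℕ} {b α β : ℕ → ℕ} (h : IsLeftPLPType n d k b α β)
    {A : Finset ℕ} (hA : A ⊆ Finset.Icc 1 n) {C : ℕ → ℕ} (hC : Monotone C)
    (hbig : ∀ p, k < p → p ≤ n → p ∉ A → C (p - 1) + d ≤ C p)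
    (hsmall : ∑ j ∈ Finset.Icc 1 k \ A, b j ≤ C k)
    (hone : ∀ p ∈ A, ∀ t, k + 1 ≤ t → t ≤ n → α t ≤ C t + if p ≤ t then 1 else 0)
    (htwo : ∀ p ∈ A, ∀ j t, k + 1 ≤ j → j ≤ t → t ≤ n →
      α t + C j ≤ β j + C t + if j < p ∧ p ≤ t then 1 else 0)
    (hfail : (∃ t, k + 1 ≤ t ∧ t ≤ n ∧ C t < α t) ∨
      ∃ j t, k + 1 ≤ j ∧ j ≤ t ∧ t ≤ n ∧ β j + C t < α t + C j) :
    IsPLPPrimeIndex n k b α β A := by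
  have hαd : ∀ t, 1 ≤ t → t ≤ n → α t ≤ d := fun t h1 h2 =>
    h.α_last ▸ h.α_mono t n h1 h2 le_rfl
  have hk1 := h.one_le_k
  have hkn := h.k_lt_n
  rcases hfail with ⟨t, ht1, ht2, hf⟩ | ⟨j, t, hj, hjt, ht, hf⟩
  · left
    -- A position of the interval outside `A` would contribute a jump of at least `d ≥ α t`, so the
    -- inequality could not fail.
    have hin : ∀ p, k + 1 ≤ p → p ≤ t → p ∈ A := by
      intro p hp1 hp2
      by_contra hp
      have h1 := hbig p (by omega) (by omega) hp
      have h2 := hC hp2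
      have h3 := hαd t (by omega) ht2
      omega
    -- Raising an entry beyond `t` cannot repair the inequality at `t`.
    have hle : ∀ p ∈ A, p ≤ t := by
      intro p hp
      by_contra hcon
      have h1 := hone p hp t ht1 ht2
      rw [if_neg hcon] at h1
      omega
    have hsd : Finset.Icc 1 k \ A.filter (· ≤ k) = Finset.Icc 1 k \ A := by
      ext x
      simp only [Finset.mem_sdiff, Finset.mem_Icc, Finset.mem_filter]
      constructor
      · rintro ⟨h1, h2⟩
        exact ⟨h1, fun h3 => h2 ⟨h3, h1.2⟩⟩
      · rintro ⟨h1, h2⟩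
        exact ⟨h1, fun h3 => h2 h3.1⟩
    refine ⟨A.filter (· ≤ k), t, ?_, ht1, ht2, ?_, ?_, ?_, ?_⟩
    · intro x hx
      have h1 := Finset.mem_filter.1 hx
      have h2 := Finset.mem_Icc.1 (hA h1.1)
      exact Finset.mem_Icc.2 ⟨h2.1, h1.2⟩
    · ext x
      simp only [Finset.mem_union, Finset.mem_filter, Finset.mem_Icc]
      constructor
      · intro hx
        by_cases hxk : x ≤ k
        · exact Or.inl ⟨hx, hxk⟩
        · exact Or.inr ⟨by omega, hle x hx⟩
      · rintro (hx | hx)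
        · exact hx.1
        · exact hin x hx.1 hx.2
    · rw [hsd, lt_min_iff]
      have h1 := hC (show k ≤ t by omega)
      refine ⟨by omega, ?_⟩
      rcases Nat.eq_or_lt_of_le ht1 with rfl | hlt
      · have := h.α_le_β (k + 1) (by omega) ht2
        omega
      -- Raising the entry at `k + 1` does not change sums over `(k + 1, t]`, so this inequality
      -- already holds for `C`; with `C t < α t` it forces `C (k + 1) < β (k + 1)`.
      · have h2 := htwo (k + 1) (hin _ le_rfl ht1) (k + 1) t le_rfl ht1 ht2
        rw [if_neg (by omega)] at h2
        have h3 := hC (show k ≤ k + 1 by omega)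
        omega
    · rcases Nat.eq_or_lt_of_le ht1 with rfl | hlt
      · have := h.α_left k hk1 le_rfl
        rw [Nat.add_sub_cancel]
        omega
      · have h2 := hone t (hin t ht1 le_rfl) (t - 1) (by omega) (by omega)
        rw [if_neg (by omega)] at h2
        have h3 := hC (show t - 1 ≤ t by omega)
        omega
    · intro i hi1 hi2
      -- The sum up to `i` does not see `t`, and the sum over `(i, t]` does not see `k + 1`. Hence
      -- `α i ≤ C i < β i`.
      have h1 := hone t (hin t ht1 le_rfl) i hi1 (by omega)
      have h2 := htwo (k + 1) (hin _ le_rfl ht1) i t hi1 hi2.le ht2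
      rw [if_neg (by omega)] at h1 h2
      omega
  · right
    have hjt' : j < t := by
      rcases Nat.eq_or_lt_of_le hjt with rfl | hlt
      · have := h.α_le_β j (by omega) ht
        omega
      · exact hlt
    have hCjt := hC hjt
    have hin : ∀ p, j + 1 ≤ p → p ≤ t → p ∈ A := by
      intro p hp1 hp2
      by_contra hp
      have h1 := hbig p (by omega) (by omega) hp
      have h2 := hC hp2
      have h3 := hC (show j ≤ p - 1 by omega)
      have h4 := hαd t (by omega) ht
      omega
    have hβα : β j < α t := by omega
    refine ⟨j + 1, t, by omega, hjt', ht, ?_, ?_, ?_, ?_, ?_⟩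
    · ext x
      rw [Finset.mem_Icc]
      refine ⟨fun hx => ?_, fun hx => hin x hx.1 hx.2⟩
      by_contra hcon
      have h1 := htwo x hx j t hj hjt ht
      rw [if_neg (show ¬ (j < x ∧ x ≤ t) from hcon)] at h1
      omega
    · rw [Nat.add_sub_cancel]
      by_contra hcon
      rcases Nat.eq_or_lt_of_le (show j + 1 ≤ t from hjt') with rfl | hlt
      · have := h.α_le_β (j + 1) (by omega) ht
        omega
      · have h1 := htwo (j + 1) (hin _ le_rfl hjt') (j + 1) t (by omega) hjt' ht
        rw [if_neg (by omega)] at h1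
        have h2 := hC (show j ≤ j + 1 by omega)
        omega
    · rcases Nat.eq_or_lt_of_le (show j + 1 ≤ t from hjt') with rfl | hlt
      · have := h.α_le_β j (by omega) (by omega)
        rw [Nat.add_sub_cancel]
        omega
      · have h1 := htwo t (hin t hjt' le_rfl) j (t - 1) hj (by omega) (by omega)
        rw [if_neg (by omega)] at h1
        have h2 := hC (show t - 1 ≤ t by omega)
        omega
    · rwa [Nat.add_sub_cancel]
    · intro i hi1 hi2
      have h1 := htwo t (hin t hjt' le_rfl) j i hj (by omega) (by omega)
      have h2 := htwo (j + 1) (hin _ le_rfl hjt') i t (by omega) hi2.le ht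
      rw [if_neg (by omega)] at h1 h2
      omega

theorem IsColonWitness.isPLPPrimeIndex {n d k : ℕ} {b α β : ℕ → ℕ}
    (h : IsLeftPLPType n d k b α β) {A : Finset ℕ} (hA : A ⊆ Finset.Icc 1 n) {w : Fin n →₀ ℕ}
    (hw : IsColonWitness (plpBases n 0 b α β) {j : Fin n | (j : ℕ) + 1 ∈ A} w) :
    IsPLPPrimeIndex n k b α β A := by
  have hkn := h.k_lt_n
  -- Outside `A` the witness may be enlarged freely: `b` fills the caps at the first `k` positions,
  -- and `d` makes the later jumps large.
  set N : ℕ → ℕ := fun j => if j + 1 ∈ A then 0 else d + b (j + 1) with hN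
  set v : Fin n →₀ ℕ := Finsupp.equivFunOnFinite.symm fun j : Fin n => N j with hv
  have hvext : ∀ j, j < n → natExt v j = N j := fun j hj => natExt_ofFun N hj
  have hv0 : ∀ i ∈ {j : Fin n | (j : ℕ) + 1 ∈ A}, v i = 0 := by
    intro i hi
    exact if_pos hi
  have hnot := hw.not_add v hv0
  have hadd : ∀ p ∈ A, ∃ i : Fin n, p = (i : ℕ) + 1 ∧
      ∃ u ∈ plpBases n 0 b α β, u ≤ w + v + Finsupp.single i 1 := by
    intro p hp
    have hp' := Finset.mem_Icc.1 (hA hp)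
    refine ⟨⟨p - 1, by omega⟩, by simp only; omega, ?_⟩
    obtain ⟨u, hu, hle⟩ := hw.add_single ⟨p - 1, by omega⟩
      (by change p - 1 + 1 ∈ A; rwa [Nat.sub_add_cancel hp'.1])
    refine ⟨u, hu, hle.trans ?_⟩
    rw [add_right_comm]
    exact le_self_add
  rw [exists_mem_plpBases_le_iff h] at hnot
  refine isPLPPrimeIndex_of_fails h hA (cappedSum_mono k b (w + v)) ?_ ?_ ?_ ?_ ?_
  · intro p hp1 hp2 hp
    obtain ⟨q, rfl⟩ : ∃ q, p = q + 1 := ⟨p - 1, by omega⟩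
    rw [Nat.add_sub_cancel, cappedSum_succ, cappedCoord, if_neg (by omega), natExt_add,
      hvext q (by omega), hN]
    simp only [if_neg hp]
    omega
  · rw [sum_Icc_sdiff_eq_sum_range]
    refine Finset.sum_le_sum fun j hj => ?_
    have hj := Finset.mem_range.1 hj
    rw [cappedCoord, if_pos hj, natExt_add, hvext j (by omega), hN]
    simp only
    split <;> omega
  · intro p hp t ht1 ht2
    obtain ⟨i, rfl, hi⟩ := hadd p hp
    rw [exists_mem_plpBases_le_iff h] at hi
    have h1 := hi.1 t ht1 ht2
    have h2 := cappedSum_add_single_le k b (w + v) i (Nat.zero_le t)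
    simp only [cappedSum, Finset.range_zero, Finset.sum_empty, Nat.succ_pos, true_and,
      add_zero] at *
    omega
  · intro p hp j t hj hjt ht
    obtain ⟨i, rfl, hi⟩ := hadd p hp
    rw [exists_mem_plpBases_le_iff h] at hi
    have h1 := hi.2 j t hj hjt ht
    have h2 := cappedSum_add_single_le k b (w + v) i hjt
    omega
  · by_contra! hcon
    exact hnot ⟨fun t h1 h2 => hcon.1 t h1 h2, fun j t h1 h2 h3 => hcon.2 j t h1 h2 h3⟩

/-! ### Sufficiency: explicit witnesses -/

theorem cappedSum_add_le_of_le {n k : ℕ} {b : ℕ → ℕ} {w x : Fin n →₀ ℕ} {j t : ℕ} (hjt : j ≤ t)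
    (hwx : ∀ i, j ≤ i → i < t → cappedCoord k b w i ≤ cappedCoord k b x i) :
    cappedSum k b w t + cappedSum k b x j ≤ cappedSum k b x t + cappedSum k b w j :=
  sum_range_add_le_of_le hjt hwx

theorem cappedSum_add_single_lt {n k : ℕ} {b : ℕ → ℕ} {w : Fin n →₀ ℕ} {i : Fin n} {j t : ℕ}
    (hji : j ≤ i) (hit : (i : ℕ) < t) (hi : (i : ℕ) < k → natExt w i < b (i + 1)) :
    cappedSum k b w t + cappedSum k b (w + Finsupp.single i 1) j <
      cappedSum k b (w + Finsupp.single i 1) t + cappedSum k b w j := by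
  refine sum_range_add_lt_of_le hji hit (fun l _ _ => cappedCoord_mono k b le_self_add l) ?_
  unfold cappedCoord
  rw [natExt_add, natExt_single, if_pos rfl]
  split
  · have := hi ‹_›
    omega
  · omega

theorem exists_isColonWitness_of_union {n d k : ℕ} {b α β : ℕ → ℕ}
    (h : IsLeftPLPType n d k b α β) {B : Finset ℕ} {t : ℕ} (hB : B ⊆ Finset.Icc 1 k)
    (ht1 : k + 1 ≤ t) (ht2 : t ≤ n)
    (hlt : ∑ j ∈ Finset.Icc 1 k \ B, b j < min (α t) (β (k + 1)))
    (hαt : α (t - 1) < α t) (hαβ : ∀ i, k + 1 ≤ i → i < t → α i < β i) :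
    ∃ w, IsColonWitness (plpBases n 0 b α β)
      {j : Fin n | (j : ℕ) + 1 ∈ B ∪ Finset.Icc (k + 1) t} w := by
  have hk1 := h.one_le_k
  have hkn := h.k_lt_n
  obtain ⟨hσα, hσβ⟩ := lt_min_iff.1 hlt
  rw [sum_Icc_sdiff_eq_sum_range] at hσα hσβ
  set σ₀ := ∑ j ∈ Finset.range k, if j + 1 ∈ B then 0 else b (j + 1) with hσ₀
  have hαd : ∀ t, 1 ≤ t → t ≤ n → α t ≤ d := fun t h1 h2 =>
    h.α_last ▸ h.α_mono t n h1 h2 le_rfl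
  have hBk : ∀ p ∈ B, p ≤ k := fun p hp => (Finset.mem_Icc.1 (hB hp)).2
  -- Prescribed capped sums from `k` to `t`: they start at `σ₀`, stay at least `α` and strictly
  -- below `β` at positions in `[k + 1, t)`, and end at `α t - 1`, one too small.
  set V : ℕ → ℕ := fun i => min (max σ₀ (α i)) (α t - 1) with hV
  have hVk : V k = σ₀ := by
    simp only [hV, h.α_left k hk1 le_rfl]
    omega
  have hVt : V t = α t - 1 := by
    simp only [hV]
    omega
  have hVmono : ∀ i, 1 ≤ i → i + 1 ≤ n → V i ≤ V (i + 1) := by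
    intro i h1 h2
    have := h.α_mono i (i + 1) h1 (by omega) h2
    simp only [hV]
    omega
  have hVα : ∀ i, 1 ≤ i → i < t → α i ≤ V i := by
    intro i h1 h2
    have := h.α_mono i (t - 1) h1 (by omega) (by omega)
    simp only [hV]
    omega
  have hVβ : ∀ i, k + 1 ≤ i → i < t → V i < β i := by
    intro i h1 h2
    have h3 := h.β_mono (k + 1) i (by omega) h1 (by omega)
    have h4 := hαβ i h1 h2
    simp only [hV]
    omega
  -- Positions of `[1, k]` outside `B` are filled to their caps and those in `B` are left empty;
  -- after `t`, entries `d` satisfy every inequality ending there.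
  set W : ℕ → ℕ := fun j => if j < k then (if j + 1 ∈ B then 0 else b (j + 1)) else
    if j < t then V (j + 1) - V j else d with hW
  set w : Fin n →₀ ℕ := Finsupp.equivFunOnFinite.symm fun j : Fin n => W j with hw
  have hwext : ∀ j, j < n → natExt w j = W j := fun j hj => natExt_ofFun W hj
  have hCk : cappedSum k b w k = σ₀ := by
    refine Finset.sum_congr rfl fun j hj => ?_
    have hj := Finset.mem_range.1 hj
    rw [cappedCoord, if_pos hj, hwext j (by omega), hW]
    simp only [if_pos hj]
    split <;> omega
  have hCV : ∀ i, k ≤ i → i ≤ t → cappedSum k b w i = V i := by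
    intro i hi
    induction i, hi using Nat.le_induction with
    | base => intro _; rw [hCk, hVk]
    | succ i hi ih =>
      intro hit
      rw [cappedSum_succ, ih (by omega), cappedCoord, if_neg (by omega), hwext i (by omega), hW]
      simp only [if_neg (show ¬ i < k by omega), if_pos (show i < t by omega)]
      have := hVmono i (by omega) (by omega)
      omega
  have hbig : ∀ j i, t < i → i ≤ n → j < i → cappedSum k b w j + d ≤ cappedSum k b w i := by
    intro j i h1 h2 h3
    obtain ⟨i, rfl⟩ : ∃ l, i = l + 1 := ⟨i - 1, by omega⟩
    have h4 := cappedSum_mono k b w (show j ≤ i by omega)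
    rw [cappedSum_succ, cappedCoord, if_neg (by omega), hwext i (by omega), hW]
    simp only [if_neg (show ¬ i < k by omega), if_neg (show ¬ i < t by omega)]
    omega
  refine ⟨w, fun i hi => ?_, fun v hv => ?_⟩
  · have hi' : (i : ℕ) + 1 ∈ B ∨ k + 1 ≤ (i : ℕ) + 1 ∧ (i : ℕ) + 1 ≤ t := by
      simpa only [Set.mem_ofPred_eq, Finset.mem_union, Finset.mem_Icc] using hi
    have hit : (i : ℕ) < t := by
      rcases hi' with hi' | hi'
      · have := hBk _ hi'
        omega
      · omega
    have hcap : (i : ℕ) < k → natExt w i < b (i + 1) := by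
      intro hik
      rw [hwext i i.2, hW]
      simp only [if_pos hik]
      rcases hi' with hi' | hi'
      · rw [if_pos hi']
        exact h.b_pos _ (by omega) (by omega)
      · omega
    have hstep : ∀ {j l}, j ≤ l → cappedSum k b w l + cappedSum k b (w + Finsupp.single i 1) j ≤
        cappedSum k b (w + Finsupp.single i 1) l + cappedSum k b w j := fun hjl =>
      cappedSum_add_le_of_le hjl fun l _ _ => cappedCoord_mono k b le_self_add l
    have hzero : ∀ x : Fin n →₀ ℕ, cappedSum k b x 0 = 0 := fun _ => rfl
    rw [exists_mem_plpBases_le_iff h]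
    constructor
    · intro l hl1 hl2
      have h1 := hstep (Nat.zero_le l)
      rw [hzero, hzero] at h1
      rcases lt_trichotomy l t with hl | rfl | hl
      · have h2 := hVα l (by omega) hl
        have h3 := hCV l (by omega) hl.le
        omega
      · have h2 := cappedSum_add_single_lt (Nat.zero_le _) hit hcap
        rw [hzero, hzero] at h2
        have h3 := hCV l (by omega) le_rfl
        omega
      · have h2 := hbig 0 l hl hl2 (by omega)
        have h3 := hαd l (by omega) hl2
        omega
    · intro j l hj hjl hl
      have h1 := hstep hjl
      rcases Nat.eq_or_lt_of_le hjl with rfl | hjl'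
      · have := h.α_le_β j (by omega) hl
        omega
      · rcases lt_trichotomy l t with hlt' | rfl | hlt'
        · have h2 := hVα l (by omega) hlt'
          have h3 := hCV l (by omega) hlt'.le
          have h4 := hCV j (by omega) (by omega)
          have h5 := hVβ j hj (by omega)
          omega
        -- The strict bound `V j < β j` absorbs the deficit of one at `t`.
        · have h3 := hCV l (by omega) le_rfl
          have h4 := hCV j (by omega) (by omega)
          have h5 := hVβ j hj (by omega)
          omega
        · have h2 := hbig j l hlt' hl hjl'
          have h3 := hαd l (by omega) hl
          omega
  · rw [exists_mem_plpBases_le_iff h]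
    rintro ⟨h1, -⟩
    have h2 := h1 t ht1 ht2
    -- Up to `t`, only positions already at their caps can be increased by `v`.
    have h3 : cappedSum k b (w + v) t ≤ cappedSum k b w t := by
      refine Finset.sum_le_sum fun j hj => ?_
      have hj := Finset.mem_range.1 hj
      have hjn : j < n := by omega
      unfold cappedCoord
      rw [natExt_add]
      by_cases hjA : j + 1 ∈ B ∪ Finset.Icc (k + 1) t
      · rw [natExt_of_lt v hjn, hv ⟨j, hjn⟩ hjA, add_zero]
      · have hjB : j + 1 ∉ B := fun hcon => hjA (Finset.mem_union_left _ hcon)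
        have hjk : j < k := by
          by_contra hcon
          exact hjA (Finset.mem_union_right _ (Finset.mem_Icc.2 ⟨by omega, by omega⟩))
        rw [if_pos hjk, if_pos hjk, hwext j hjn, hW]
        simp only [if_pos hjk, if_neg hjB]
        omega
    have h4 := hCV t (by omega) le_rfl
    omega

theorem exists_isColonWitness_of_Icc {n d k : ℕ} {b α β : ℕ → ℕ}
    (h : IsLeftPLPType n d k b α β) {s t : ℕ} (hs : k + 2 ≤ s) (hst : s ≤ t) (ht : t ≤ n)
    (hβs : β (s - 1) < β s) (hαt : α (t - 1) < α t) (hβα : β (s - 1) < α t)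
    (hαβ : ∀ i, s ≤ i → i < t → α i < β i) :
    ∃ w, IsColonWitness (plpBases n 0 b α β)
      {j : Fin n | (j : ℕ) + 1 ∈ Finset.Icc s t} w := by
  have hk1 := h.one_le_k
  have hkn := h.k_lt_n
  -- From here on `s` denotes the old `s - 1`, the left end `j` of the inequality that is to fail.
  obtain ⟨s, rfl⟩ : ∃ r, s = r + 1 := ⟨s - 1, by omega⟩
  rw [Nat.add_sub_cancel] at hβs hβα
  have hαd : ∀ t, 1 ≤ t → t ≤ n → α t ≤ d := fun t h1 h2 =>
    h.α_last ▸ h.α_mono t n h1 h2 le_rfl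
  -- Capped sums on `[s, t]` up to an additive constant: from `β s` to `α t - 1`, so the inequality
  -- for `(s, t]` fails by exactly one.
  set V : ℕ → ℕ := fun i => min (max (β s) (α i)) (α t - 1) with hV
  have hVs : V s = β s := by
    have := h.α_le_β s (by omega) (by omega)
    simp only [hV]
    omega
  have hVt : V t = α t - 1 := by
    simp only [hV]
    omega
  have hVmono : ∀ i, 1 ≤ i → i + 1 ≤ n → V i ≤ V (i + 1) := by
    intro i h1 h2
    have := h.α_mono i (i + 1) h1 (by omega) h2
    simp only [hV]
    omega
  have hVα : ∀ i, 1 ≤ i → i < t → α i ≤ V i := by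
    intro i h1 h2
    have := h.α_mono i (t - 1) h1 (by omega) (by omega)
    simp only [hV]
    omega
  have hVβ : ∀ i, s + 1 ≤ i → i < t → V i < β i := by
    intro i h1 h2
    have h3 := h.β_mono (s + 1) i (by omega) h1 (by omega)
    have h4 := hαβ i h1 h2
    simp only [hV]
    omega
  set W : ℕ → ℕ := fun j => if s ≤ j ∧ j < t then V (j + 1) - V j else d with hW
  set w : Fin n →₀ ℕ := Finsupp.equivFunOnFinite.symm fun j : Fin n => W j with hw
  have hwext : ∀ j, j < n → natExt w j = W j := fun j hj => natExt_ofFun W hj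
  have hCV : ∀ i, s ≤ i → i ≤ t → cappedSum k b w i + β s = cappedSum k b w s + V i := by
    intro i hi
    induction i, hi using Nat.le_induction with
    | base => intro _; rw [hVs]
    | succ i hi ih =>
      intro hit
      have h1 := ih (by omega)
      rw [cappedSum_succ, cappedCoord, if_neg (by omega), hwext i (by omega), hW]
      simp only [if_pos (show s ≤ i ∧ i < t by omega)]
      have := hVmono i (by omega) (by omega)
      omega
  have hbig : ∀ j i, k < i → i ≤ n → (i ≤ s ∨ t < i) → j < i →
      cappedSum k b w j + d ≤ cappedSum k b w i := by
    intro j i h1 h2 h3 h4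
    obtain ⟨i, rfl⟩ : ∃ l, i = l + 1 := ⟨i - 1, by omega⟩
    have h4 := cappedSum_mono k b w (show j ≤ i by omega)
    rw [cappedSum_succ, cappedCoord, if_neg (by omega), hwext i (by omega), hW]
    simp only [if_neg (show ¬ (s ≤ i ∧ i < t) by omega)]
    omega
  refine ⟨w, fun i hi => ?_, fun v hv => ?_⟩
  · have hi' : s + 1 ≤ (i : ℕ) + 1 ∧ (i : ℕ) + 1 ≤ t := by
      simpa only [Set.mem_ofPred_eq, Finset.mem_Icc] using hi
    have hstep : ∀ {j l}, j ≤ l → cappedSum k b w l + cappedSum k b (w + Finsupp.single i 1) j ≤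
        cappedSum k b (w + Finsupp.single i 1) l + cappedSum k b w j := fun hjl =>
      cappedSum_add_le_of_le hjl fun l _ _ => cappedCoord_mono k b le_self_add l
    have hzero : ∀ x : Fin n →₀ ℕ, cappedSum k b x 0 = 0 := fun _ => rfl
    rw [exists_mem_plpBases_le_iff h]
    constructor
    · intro l hl1 hl2
      have h1 := hstep (Nat.zero_le l)
      rw [hzero, hzero] at h1
      -- Position `k + 1 ≤ s` carries an entry `d`, so all inequalities of the first kind hold.
      have h2 := hbig 0 (k + 1) (by omega) (by omega) (by omega) (by omega)
      have h3 := hαd l (by omega) hl2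
      have h4 := cappedSum_mono k b w hl1
      omega
    · intro j l hj hjl hl
      have h1 := hstep hjl
      have hd := hαd l (by omega) hl
      rcases Nat.eq_or_lt_of_le hjl with rfl | hjl'
      · have := h.α_le_β j (by omega) hl
        omega
      · by_cases hls : l ≤ s ∨ t < l
        · have h2 := hbig j l (by omega) hl hls hjl'
          omega
        · by_cases hjs : j < s
          · have h2 := hbig j s (by omega) (by omega) (by omega) hjs
            have h3 := cappedSum_mono k b w (show s ≤ l by omega)
            omega
          · have h2 := hCV l (by omega) (by omega)
            have h3 := hCV j (by omega) (by omega)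
            rcases Nat.eq_or_lt_of_le (show s ≤ j by omega) with rfl | hsj
            · rcases Nat.eq_or_lt_of_le (show l ≤ t by omega) with rfl | hlt
              · have h4 := cappedSum_add_single_lt (k := k) (b := b) (w := w)
                  (show s ≤ (i : ℕ) by omega) (show (i : ℕ) < l by omega) (by omega)
                omega
              · have h4 := hVα l (by omega) hlt
                omega
            · have h5 := hVβ j (by omega) (by omega)
              rcases Nat.eq_or_lt_of_le (show l ≤ t by omega) with rfl | hlt
              · omega
              · have h4 := hVα l (by omega) hlt
                omega
  · rw [exists_mem_plpBases_le_iff h]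
    rintro ⟨-, h1⟩
    have h2 := h1 s t (by omega) (by omega) ht
    have h3 : cappedSum k b (w + v) t + cappedSum k b w s ≤
        cappedSum k b w t + cappedSum k b (w + v) s := by
      refine cappedSum_add_le_of_le (by omega) fun j hj1 hj2 => ?_
      have hjn : j < n := by omega
      unfold cappedCoord
      rw [natExt_add, natExt_of_lt v hjn,
        hv ⟨j, hjn⟩ (Finset.mem_Icc.2 ⟨Nat.succ_le_succ hj1, hj2⟩), add_zero]
    have h4 := hCV t (by omega) le_rfl
    omega

theorem exists_isColonWitness_iff {n d k : ℕ} {b α β : ℕ → ℕ}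
    (h : IsLeftPLPType n d k b α β) {A : Finset ℕ} (hA : A ⊆ Finset.Icc 1 n) :
    (∃ w, IsColonWitness (plpBases n 0 b α β) {j : Fin n | (j : ℕ) + 1 ∈ A} w) ↔
      IsPLPPrimeIndex n k b α β A := by
  constructor
  · rintro ⟨w, hw⟩
    exact hw.isPLPPrimeIndex h hA
  · rintro (⟨B, t, hB, ht1, ht2, rfl, h1, h2, h3⟩ | ⟨s, t, hs, hst, ht, rfl, h1, h2, h3, h4⟩)
    · exact exists_isColonWitness_of_union h hB ht1 ht2 h1 h2 h3
    · exact exists_isColonWitness_of_Icc h hs hst ht h1 h2 h3 h4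

/-! ### Powers of the ideal -/

theorem partialSum_add {n : ℕ} (u v : Fin n →₀ ℕ) (i : ℕ) :
    partialSum (u + v) i = partialSum u i + partialSum v i := by
  simp [partialSum, Finset.sum_add_distrib]

theorem partialSum_ofFun_sub {n : ℕ} {V : ℕ → ℕ} (hV : Monotone V) (h0 : V 0 = 0) {i : ℕ}
    (hi : i ≤ n) :
    partialSum (Finsupp.equivFunOnFinite.symm fun j : Fin n => V (j + 1) - V j) i = V i := by
  rw [partialSum_eq_sum_range]
  calc _ = ∑ j ∈ Finset.range i, (V (j + 1) - V j) :=
        Finset.sum_congr rfl fun j hj =>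
          natExt_ofFun (fun j => V (j + 1) - V j) ((Finset.mem_range.1 hj).trans_le hi)
    _ = V i := by rw [Finset.sum_range_tsub hV, h0, tsub_zero]

theorem monotone_sub_div_succ (m : ℕ) : Monotone fun x : ℕ => x - x / (m + 1) := by
  refine monotone_nat_of_le_succ fun x => ?_
  have h1 : (x + 1) / (m + 1) ≤ x / (m + 1) + 1 := by
    rw [← Nat.add_div_right x (Nat.succ_pos m)]
    exact Nat.div_le_div_right (by omega)
  have h2 := Nat.div_le_self x (m + 1)
  omega

theorem add_mul_sub_div_succ (m x y : ℕ) :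
    x + (m + 1) * y - (x + (m + 1) * y) / (m + 1) = x - x / (m + 1) + m * y := by
  rw [Nat.add_mul_div_left x y (show 0 < m + 1 by omega)]
  have := Nat.div_le_self x (m + 1)
  rw [add_one_mul]
  omega

/-- The integer decomposition property of pruned lattice path polymatroids. -/
theorem exists_add_of_mem_plpBases_succ_mul {n m : ℕ} {b α β : ℕ → ℕ} {u : Fin n →₀ ℕ}
    (hu : u ∈ plpBases n 0 (fun i => (m + 1) * b i) (fun i => (m + 1) * α i)
      fun i => (m + 1) * β i) :
    ∃ v ∈ plpBases n 0 (fun i => m * b i) (fun i => m * α i) fun i => m * β i,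
      ∃ x ∈ plpBases n 0 b α β, v + x = u := by
  obtain ⟨hu1, hu2⟩ := hu
  set U : ℕ → ℕ := partialSum u with hU
  have hU0 : U 0 = 0 := by rw [hU, partialSum_eq_sum_range]; rfl
  have hUs : ∀ j : Fin n, U (j + 1) = U j + u j := by
    intro j
    rw [hU, partialSum_eq_sum_range, partialSum_eq_sum_range, Finset.sum_range_succ,
      natExt_of_lt u j.2]
  have hUmono : Monotone U := by
    refine monotone_nat_of_le_succ fun i => ?_
    rw [hU, partialSum_eq_sum_range, partialSum_eq_sum_range, Finset.sum_range_succ]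
    exact Nat.le_add_right _ _
  -- Each partial sum splits as `F + G`. Both maps are monotone and turn a shift by `(m + 1) * y`
  -- into shifts by `y` and `m * y`, so every bound on `u` is inherited by the two vectors of
  -- differences.
  set F : ℕ → ℕ := fun x => x / (m + 1) with hF
  set G : ℕ → ℕ := fun x => x - x / (m + 1) with hG
  have hFmono : Monotone F := fun x y hxy => Nat.div_le_div_right hxy
  have hGmono : Monotone G := monotone_sub_div_succ m
  have hFadd : ∀ x y, F (x + (m + 1) * y) = F x + y := fun x y =>
    Nat.add_mul_div_left _ _ (Nat.succ_pos m)
  have hGadd : ∀ x y, G (x + (m + 1) * y) = G x + m * y := add_mul_sub_div_succ m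
  have hF0 : F 0 = 0 := Nat.zero_div _
  have hG0 : G 0 = 0 := Nat.zero_sub _
  have hFG : ∀ x, G x + F x = x := fun x => Nat.sub_add_cancel (Nat.div_le_self _ _)
  have hFm : ∀ y, F ((m + 1) * y) = y := fun y => by
    have := hFadd 0 y; rwa [zero_add, hF0, zero_add] at this
  have hGm : ∀ y, G ((m + 1) * y) = m * y := fun y => by
    have := hGadd 0 y; rwa [zero_add, hG0, zero_add] at this
  refine ⟨Finsupp.equivFunOnFinite.symm fun j : Fin n => G (U (j + 1)) - G (U j),
    ⟨fun j => ⟨Nat.zero_le _, ?_⟩, fun i hi1 hi2 => ?_⟩,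
    Finsupp.equivFunOnFinite.symm fun j : Fin n => F (U (j + 1)) - F (U j),
    ⟨fun j => ⟨Nat.zero_le _, ?_⟩, fun i hi1 hi2 => ?_⟩, ?_⟩
  · have h1 := hGmono (show U (j + 1) ≤ U j + (m + 1) * b (j + 1) by
      rw [hUs]; exact Nat.add_le_add_left (hu1 j).2 _)
    rw [hGadd] at h1
    exact Nat.sub_le_iff_le_add'.2 h1
  · rw [partialSum_ofFun_sub (V := fun i => G (U i)) (hGmono.comp hUmono)
      (by simp only [hU0, hG0]) hi2]
    have h1 := hGmono (hu2 i hi1 hi2).1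
    have h2 := hGmono (hu2 i hi1 hi2).2
    rw [hGm] at h1 h2
    exact ⟨h1, h2⟩
  · have h1 := hFmono (show U (j + 1) ≤ U j + (m + 1) * b (j + 1) by
      rw [hUs]; exact Nat.add_le_add_left (hu1 j).2 _)
    rw [hFadd] at h1
    exact Nat.sub_le_iff_le_add'.2 h1
  · rw [partialSum_ofFun_sub (V := fun i => F (U i)) (hFmono.comp hUmono)
      (by simp only [hU0, hF0]) hi2]
    have h1 := hFmono (hu2 i hi1 hi2).1
    have h2 := hFmono (hu2 i hi1 hi2).2
    rw [hFm] at h1 h2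
    exact ⟨h1, h2⟩
  · ext j
    have h1 := hUs j
    have h2 := hFG (U j)
    have h3 := hFG (U (j + 1))
    have h4 := hFmono (hUmono (Nat.le_succ (j : ℕ)))
    have h5 := hGmono (hUmono (Nat.le_succ (j : ℕ)))
    change G (U (j + 1)) - G (U j) + (F (U (j + 1)) - F (U j)) = u j
    simp only [Nat.succ_eq_add_one] at h4 h5
    omega

theorem add_mem_plpBases_succ_mul {n m : ℕ} {b α β : ℕ → ℕ} {v x : Fin n →₀ ℕ}
    (hv : v ∈ plpBases n 0 (fun i => m * b i) (fun i => m * α i) fun i => m * β i)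
    (hx : x ∈ plpBases n 0 b α β) :
    v + x ∈ plpBases n 0 (fun i => (m + 1) * b i) (fun i => (m + 1) * α i)
      fun i => (m + 1) * β i := by
  refine ⟨fun j => ⟨Nat.zero_le _, ?_⟩, fun i hi1 hi2 => ?_⟩
  · simp only [add_one_mul]
    exact Nat.add_le_add (hv.1 j).2 (hx.1 j).2
  · simp only [partialSum_add, add_one_mul]
    exact ⟨Nat.add_le_add (hv.2 i hi1 hi2).1 (hx.2 i hi1 hi2).1,
      Nat.add_le_add (hv.2 i hi1 hi2).2 (hx.2 i hi1 hi2).2⟩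

theorem plpIdeal_pow (K : Type*) [Field K] (n : ℕ) (b α β : ℕ → ℕ) (m : ℕ) :
    plpIdeal K n 0 b α β ^ m =
      plpIdeal K n 0 (fun i => m * b i) (fun i => m * α i) fun i => m * β i := by
  induction m with
  | zero =>
    -- For `m = 0` all bounds vanish, and the exponent `0` contributes the generator `1`.
    rw [pow_zero, Ideal.one_eq_top, eq_comm, Ideal.eq_top_iff_one]
    exact Ideal.subset_span ⟨0, ⟨fun j => by simp, fun i _ _ => by simp [partialSum]⟩, rfl⟩
  | succ m ih =>
    rw [pow_succ, ih, plpIdeal, plpIdeal, plpIdeal, Ideal.span_mul_span']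
    congr 1
    ext f
    simp only [Set.mem_mul, Set.mem_image]
    constructor
    · rintro ⟨_, ⟨v, hv, rfl⟩, _, ⟨x, hx, rfl⟩, rfl⟩
      exact ⟨v + x, add_mem_plpBases_succ_mul hv hx, by simp [MvPolynomial.monomial_mul]⟩
    · rintro ⟨u, hu, rfl⟩
      obtain ⟨v, hv, x, hx, rfl⟩ := exists_add_of_mem_plpBases_succ_mul hu
      exact ⟨_, ⟨v, hv, rfl⟩, _, ⟨x, hx, rfl⟩, by simp [MvPolynomial.monomial_mul]⟩

theorem IsLeftPLPType.mul {n d k : ℕ} {b α β : ℕ → ℕ} (h : IsLeftPLPType n d k b α β) {m : ℕ}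
    (hm : 0 < m) :
    IsLeftPLPType n (m * d) k (fun i => m * b i) (fun i => m * α i) fun i => m * β i where
  n_pos := h.n_pos
  d_pos := Nat.mul_pos hm h.d_pos
  α_mono i j h1 h2 h3 := Nat.mul_le_mul_left m (h.α_mono i j h1 h2 h3)
  β_mono i j h1 h2 h3 := Nat.mul_le_mul_left m (h.β_mono i j h1 h2 h3)
  α_last := congrArg (m * ·) h.α_last
  β_last := congrArg (m * ·) h.β_last
  α_le_β i h1 h2 := Nat.mul_le_mul_left m (h.α_le_β i h1 h2)
  one_le_k := h.one_le_k
  k_lt_n := h.k_lt_n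
  b_pos i h1 h2 := Nat.mul_pos hm (h.b_pos i h1 h2)
  le_b i h1 h2 := Nat.mul_le_mul_left m (h.le_b i h1 h2)
  α_left i h1 h2 := by rw [h.α_left i h1 h2, mul_zero]
  β_left i h1 h2 := congrArg (m * ·) (h.β_left i h1 h2)

theorem isPLPPrimeIndex_mul_iff {n k m : ℕ} (b α β : ℕ → ℕ) (hm : 0 < m) (A : Finset ℕ) :
    IsPLPPrimeIndex n k (fun i => m * b i) (fun i => m * α i) (fun i => m * β i) A ↔
      IsPLPPrimeIndex n k b α β A := by
  simp only [IsPLPPrimeIndex, ← Finset.mul_sum, lt_min_iff, Nat.mul_lt_mul_left hm]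

/-! ### The associated primes and their stability -/

theorem monomialPrime_eq_span_image (K : Type*) [Field K] (n : ℕ) (A : Finset ℕ) :
    monomialPrime K n A =
      Ideal.span (MvPolynomial.X '' {j : Fin n | (j : ℕ) + 1 ∈ A}) := by
  rw [monomialPrime]
  congr 1
  ext f
  simp only [Set.mem_ofPred_eq, Set.mem_image]
  exact exists_congr fun j => and_congr_right fun _ => eq_comm

/-- Arbitrary `P` are allowed, not only the primes `P_A`, so that the sets `Ass(S/I^m)` can be
compared as a whole. -/
theorem mem_associatedPrimes_plpIdeal_iff {K : Type*} [Field K] {n d k : ℕ} {b α β : ℕ → ℕ}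
    (h : IsLeftPLPType n d k b α β) {P : Ideal (MvPolynomial (Fin n) K)} :
    P ∈ associatedPrimes (MvPolynomial (Fin n) K)
        (MvPolynomial (Fin n) K ⧸ plpIdeal K n 0 b α β) ↔
      ∃ A ⊆ Finset.Icc 1 n, P = monomialPrime K n A ∧ IsPLPPrimeIndex n k b α β A := by
  classical
  rw [plpIdeal, mem_associatedPrimes_span_monomial_iff]
  constructor
  · rintro ⟨A, rfl, hw⟩
    set A' : Finset ℕ := (Finset.univ.filter fun j : Fin n => j ∈ A).image
      fun j : Fin n => (j : ℕ) + 1 with hA'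
    have hA : {j : Fin n | (j : ℕ) + 1 ∈ A'} = A := by
      ext j
      simp [hA', Fin.val_inj]
    have hsub : A' ⊆ Finset.Icc 1 n := by
      intro x hx
      obtain ⟨j, -, rfl⟩ := Finset.mem_image.1 hx
      exact Finset.mem_Icc.2 ⟨by omega, j.2⟩
    refine ⟨A', hsub, ?_, ?_⟩
    · rw [monomialPrime_eq_span_image, hA]
    · rw [← exists_isColonWitness_iff h hsub, hA]
      exact hw
  · rintro ⟨A, hA, rfl, hi⟩
    exact ⟨_, monomialPrime_eq_span_image K n A, (exists_isColonWitness_iff h hA).2 hi⟩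

theorem monomialPrime_injOn (K : Type*) [Field K] {n : ℕ} {A B : Finset ℕ}
    (hA : A ⊆ Finset.Icc 1 n) (hB : B ⊆ Finset.Icc 1 n)
    (h : monomialPrime K n A = monomialPrime K n B) : A = B := by
  rw [monomialPrime_eq_span_image, monomialPrime_eq_span_image] at h
  have hAB := span_X_image_injective h
  have key : ∀ x ∈ Finset.Icc 1 n, x ∈ A ↔ x ∈ B := by
    intro x hx
    obtain ⟨h1, h2⟩ := Finset.mem_Icc.1 hx
    have := Set.ext_iff.1 hAB ⟨x - 1, by omega⟩
    simpa only [Set.mem_ofPred_eq, Nat.sub_add_cancel h1] using this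
  ext x
  exact ⟨fun hx => (key x (hA hx)).1 hx, fun hx => (key x (hB hx)).2 hx⟩

theorem associatedPrimes_plpIdeal_pow {K : Type*} [Field K] {n d k : ℕ} {b α β : ℕ → ℕ}
    (h : IsLeftPLPType n d k b α β) {m : ℕ} (hm : 1 ≤ m) :
    associatedPrimes (MvPolynomial (Fin n) K)
        (MvPolynomial (Fin n) K ⧸ plpIdeal K n 0 b α β ^ m) =
      associatedPrimes (MvPolynomial (Fin n) K)
        (MvPolynomial (Fin n) K ⧸ plpIdeal K n 0 b α β) := by
  ext P
  rw [plpIdeal_pow, mem_associatedPrimes_plpIdeal_iff (h.mul hm),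
    mem_associatedPrimes_plpIdeal_iff h]
  simp only [isPLPPrimeIndex_mul_iff b α β hm]

theorem mainTheorem7 (K : Type*) [Field K] (n d k : ℕ) (b α β : ℕ → ℕ)
    (h : IsLeftPLPType n d k b α β)
    (I : Ideal (MvPolynomial (Fin n) K)) (hI : I = plpIdeal K n 0 b α β) :
    (∀ A : Finset ℕ, A ⊆ Finset.Icc 1 n →
      (monomialPrime K n A ∈
          associatedPrimes (MvPolynomial (Fin n) K) (MvPolynomial (Fin n) K ⧸ I) ↔
        (∃ (B : Finset ℕ) (t : ℕ), B ⊆ Finset.Icc 1 k ∧ k + 1 ≤ t ∧ t ≤ n ∧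
          A = B ∪ Finset.Icc (k + 1) t ∧
          ∑ j ∈ Finset.Icc 1 k \ B, b j < min (α t) (β (k + 1)) ∧
          α (t - 1) < α t ∧
          ∀ i, k + 1 ≤ i → i < t → α i < β i) ∨
        (∃ s t : ℕ, k + 2 ≤ s ∧ s ≤ t ∧ t ≤ n ∧
          A = Finset.Icc s t ∧
          β (s - 1) < β s ∧
          α (t - 1) < α t ∧
          β (s - 1) < α t ∧
          ∀ i, s ≤ i → i < t → α i < β i))) ∧
    (∀ m : ℕ, 1 ≤ m →
      associatedPrimes (MvPolynomial (Fin n) K) (MvPolynomial (Fin n) K ⧸ I ^ m) =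
        associatedPrimes (MvPolynomial (Fin n) K) (MvPolynomial (Fin n) K ⧸ I)) ∧
    astab I = 1 := by
  subst hI
  refine ⟨fun A hA => ?_, fun m hm => associatedPrimes_plpIdeal_pow h hm, ?_⟩
  · change _ ↔ IsPLPPrimeIndex n k b α β A
    rw [mem_associatedPrimes_plpIdeal_iff h]
    constructor
    · rintro ⟨A', hA', heq, hi⟩
      rwa [monomialPrime_injOn K hA hA' heq]
    · exact fun hi => ⟨A, hA, rfl, hi⟩
  · have hmem : 1 ∈ {m : ℕ | 1 ≤ m ∧ ∀ l, m ≤ l →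
        associatedPrimes (MvPolynomial (Fin n) K)
            (MvPolynomial (Fin n) K ⧸ plpIdeal K n 0 b α β ^ m) =
          associatedPrimes (MvPolynomial (Fin n) K)
            (MvPolynomial (Fin n) K ⧸ plpIdeal K n 0 b α β ^ l)} :=
      ⟨le_rfl, fun l hl => by
        rw [associatedPrimes_plpIdeal_pow h le_rfl, associatedPrimes_plpIdeal_pow h hl]⟩
    exact le_antisymm (Nat.sInf_le hmem) (Nat.sInf_mem ⟨1, hmem⟩).1
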